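/- Fix an integer $r\ge 1$ and a constant $C_0\ge 0$. There is a constant $C$, depending only on $r$ and $C_0$, such that the following holds. Let $(X,\mu)$ be a $\sigma$-finite measure space, let $0\le s\le r$ be an integer, and let $f_1,\dots,f_L$ be a finite family of complex-valued functions in $L^{2r}(X,\mu)$ which satisfies $s$-Type IV superorthogonality for $2r$-tuples, that is, $$\int_X f_{l_1}\overline{f_{l_2}}\cdots f_{l_{2r-1}}\overline{f_{l_{2r}}}\,d\mu=0$$ for all indices $l_1,\dots,l_{2r}\in\{1,\dots,L\}$ such that the indices $l_i$ ($1\le i\le 2r-2s$) and $l_{2j-1}$ ($r-s<j\le r$) are all distinct and $l_{2j-1}=l_{2j}$ for all $r-s<j\le r$. Assume also that $$\Big\|\Big(\sum_{l=1}^L|f_l|^{2r}\Big)^{\frac1{2r}}\Big\|_{L^{2r}(\mu)}\le C_0\,\Big\|\sum_{l=1}^L f_l\Big\|_{L^{2r}(\mu)}.$$ Then $$\Big\|\Big(\sum_{l=1}^L|f_l|^{2}\Big)^{\frac12}\Big\|_{L^{2r}(\mu)}\le C\,\Big\|\sum_{l=1}^L f_l\Big\|_{L^{2r}(\mu)}.$$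 -/

import Mathlib

open MeasureTheory
open scoped NNReal ENNReal ComplexConjugate

/-- The integrand `f_{l₁} · conj f_{l₂} ⋯ f_{l_{2r-1}} · conj f_{l_{2r}}`. The tuple is indexed from
`0`, so the odd positions `1, 3, …` (no conjugate) of `1, …, 2r` are the even elements of `Fin (2 * r)`. -/
noncomputable def alternatingProduct {X : Type*} {L : ℕ} (r : ℕ) (f : Fin L → X → ℂ)
    (l : Fin (2 * r) → Fin L) (x : X) : ℂ :=
  ∏ i : Fin (2 * r), if Even (i : ℕ) then f (l i) x else conj (f (l i) x)

/-- The index tuples tested by `s`-Type IV superorthogonality. In the numbering `1, …, 2r`: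
the indices `l_i` (`1 ≤ i ≤ 2r - 2s`) and `l_{2j-1}` (`r - s < j ≤ r`) are all distinct, and
`l_{2j-1} = l_{2j}` for `r - s < j ≤ r`. Below the positions are numbered from `0`. -/
structure IsTypeIVTuple {L : ℕ} (r s : ℕ) (l : Fin (2 * r) → Fin L) : Prop where
  distinct : Set.InjOn l {i : Fin (2 * r) | (i : ℕ) + 2 * s < 2 * r ∨ Even (i : ℕ)}
  paired : ∀ i k : Fin (2 * r), 2 * r ≤ (i : ℕ) + 2 * s → Even (i : ℕ) →
    (k : ℕ) = (i : ℕ) + 1 → l i = l k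

/-- `s`-Type IV superorthogonality for `2r`-tuples. -/
def TypeIVSuperorthogonal {X : Type*} [MeasurableSpace X] (μ : Measure X) {L : ℕ} (r s : ℕ)
    (f : Fin L → X → ℂ) : Prop :=
  ∀ l : Fin (2 * r) → Fin L, IsTypeIVTuple r s l → ∫ x, alternatingProduct r f l x ∂μ = 0

/-! Write r = m + s, F = ∑ f_l and S² = ∑ |f_l|². At a point x, let D(x) be the sum of the integrand
over all Type IV tuples. It is a sum over distinct indices with m factors f, m factors conj f and s
factors |f|², and superorthogonality gives ∫ D = 0. So it suffices to prove the pointwise bound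
S^(2r) ≤ 2 (-1)^m Re D + K (|F|^(2r) + ∑ |f_l|^(2r)) (`exists_sum_sq_pow_le`), integrate it, and use
the hypothesis on ∑ |f_l|^(2r).

If |F| or some |f_l| exceeds δS, the last term controls S^(2r), and the crude bound
`norm_distinctSum_le` controls D. Otherwise expand D by removing the distinctness constraints one
index at a time (`distinctSum_insert`); each coincidence of indices costs a factor -1. A block of
one index sums to F or its conjugate, and a block of total degree at least 3 also gains a factor δ.
Up to O(δ) S^(2r), each |f|² therefore contributes S² by itself, and the other 2m factors contribute
only through perfect matchings, all with sign (-1)^m. A mixed pair gives S². The pairs f·f and conj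
f·conj f are equally numerous and together give powers of |∑ f_l²|². Every matching thus has the
same sign, a matching with mixed pairs only gives S^(2m), and (-1)^m Re D ≥ (1 - Cδ) S^(2r)
(`exists_typeIV_re_ge`). -/

/-! ### Sums over distinct indices and their recursion. -/

section DistinctSum

variable {ι β : Type*} [Fintype β]

/-- The sum of `∏ i ∈ I, g i (x i)` over all families `(x i)` with pairwise distinct entries. -/
noncomputable def distinctSum (I : Finset ι) (g : ι → β → ℂ) : ℂ :=
  ∑ e : I ↪ β, ∏ i : I, g i (e i)

lemma distinctSum_congr {I : Finset ι} {g h : ι → β → ℂ} (H : ∀ i ∈ I, g i = h i) :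
    distinctSum I g = distinctSum I h := by
  unfold distinctSum
  refine Finset.sum_congr rfl fun e _ => Finset.prod_congr rfl fun i _ => ?_
  rw [H i i.2]

lemma distinctSum_empty (g : ι → β → ℂ) : distinctSum ∅ g = 1 := by
  simp [distinctSum]

variable [DecidableEq ι]

/-- Let the index at `n` run freely and subtract the coincidences. The other indices are distinct,
so it can meet only one of them, say the one at `i`; the factors there then merge into `g i * g n`.
-/
lemma distinctSum_insert {I : Finset ι} {n : ι} (hn : n ∉ I) (g : ι → β → ℂ) :
    distinctSum (insert n I) g = (∑ x, g n x) * distinctSum I g -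
      ∑ i ∈ I, distinctSum I (Function.update g i (g i * g n)) := by
  classical
  have h0 : distinctSum (insert n I) g =
      ∑ e : I ↪ β, (∑ x : ((Set.range e)ᶜ : Set β), g n x) * ∏ i : I, g i (e i) := by
    unfold distinctSum
    let E : (↥(insert n I) ↪ β) ≃ (Σ e : I ↪ β, ↥(Set.range e)ᶜ) :=
      (Equiv.embeddingCongr (Finset.subtypeInsertEquivOption hn) (Equiv.refl β)).trans
        (Function.Embedding.optionEmbeddingEquiv I β)
    have h : ∀ e : ↥(insert n I) ↪ β, ∏ i : ↥(insert n I), g i (e i) =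
        (g n (E e).2) * ∏ i : I, g i ((E e).1 i) := by
      intro e
      rw [← Equiv.prod_comp (Finset.subtypeInsertEquivOption hn).symm, Fintype.prod_option]
      rfl
    rw [Finset.sum_congr rfl fun e _ => h e,
      Equiv.sum_comp E (fun p => (g n p.2) * ∏ i : I, g i (p.1 i)), Fintype.sum_sigma]
    simp only [Finset.sum_mul]
  have h1 : ∀ e : I ↪ β, ∑ x : ((Set.range e)ᶜ : Set β), g n x =
      ∑ x, g n x - ∑ i : I, g n (e i) := by
    intro e
    rw [eq_sub_iff_add_eq, ← Finset.sum_map Finset.univ e (g n),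
      ← Finset.sum_coe_sort (Finset.univ.map e) (g n)]
    have := Finset.sum_compl_add_sum (Finset.univ.map e) (g n)
    rw [← this, ← Finset.sum_coe_sort (Finset.univ.map e) (g n)]
    congr 1
    refine (Finset.sum_subtype _ ?_ _).symm
    intro x; simp
  have h2 : ∀ (e : I ↪ β) (j : I), ∏ i : I, Function.update g (j : ι) (g j * g n) i (e i) =
      g n (e j) * ∏ i : I, g i (e i) := by
    intro e j
    rw [← Finset.mul_prod_erase Finset.univ _ (Finset.mem_univ j),
      ← Finset.mul_prod_erase Finset.univ (fun i : I => g i (e i)) (Finset.mem_univ j)]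
    have : ∀ i ∈ Finset.univ.erase j, Function.update g (j : ι) (g j * g n) i (e i) =
        g i (e i) := by
      intro i hi
      rw [Function.update_of_ne]
      exact fun h => (Finset.ne_of_mem_erase hi) (Subtype.ext h)
    rw [Finset.prod_congr rfl this]
    simp
    ring
  rw [h0]
  simp only [h1, sub_mul, Finset.sum_sub_distrib, ← Finset.mul_sum]
  congr 1
  rw [← Finset.sum_coe_sort I]
  unfold distinctSum
  rw [Finset.sum_comm]
  refine Finset.sum_congr rfl fun e _ => ?_
  rw [Finset.sum_mul]
  exact Finset.sum_congr rfl fun j _ => (h2 e j).symm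

end DistinctSum

/-! ### Size of distinct sums, counted by degree in f. -/

section Weights

variable {ι β : Type*} [Fintype β]

/-- The sum and every entry of `f` are at most `δ * S`, and its square function is at most `S`. -/
structure ScaleControl (f : β → ℂ) (S δ : ℝ) : Prop where
  scale_nonneg : 0 ≤ S
  ratio_nonneg : 0 ≤ δ
  ratio_le_one : δ ≤ 1
  sum_sq_le : ∑ x, ‖f x‖ ^ 2 ≤ S ^ 2
  norm_le : ∀ x, ‖f x‖ ≤ δ * S
  norm_sum_le : ‖∑ x, f x‖ ≤ δ * S

/-- `h` is of size `|f| ^ w`; when `w = 1`, its sum is small. -/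
structure HasWeight (f : β → ℂ) (S δ : ℝ) (w : ℕ) (h : β → ℂ) : Prop where
  pos : 1 ≤ w
  norm_le : ∀ x, ‖h x‖ ≤ ‖f x‖ ^ w
  norm_sum_le : w = 1 → ‖∑ x, h x‖ ≤ δ * S

variable {f : β → ℂ} {S δ : ℝ}

lemma HasWeight.mul {v w : ℕ} {g h : β → ℂ} (hg : HasWeight f S δ v g)
    (hh : HasWeight f S δ w h) : HasWeight f S δ (v + w) (g * h) where
  pos := le_add_right hg.pos
  norm_le x := by
    rw [Pi.mul_apply, norm_mul, pow_add]
    exact mul_le_mul (hg.norm_le x) (hh.norm_le x) (norm_nonneg _) (by positivity)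
  norm_sum_le h1 := by have := hg.pos; have := hh.pos; omega

/-- Two powers of |f| are summed to S²; each remaining power is bounded by its maximum δS. -/
lemma HasWeight.norm_sum_le_of_two_le (hf : ScaleControl f S δ) {w : ℕ} {h : β → ℂ}
    (hh : HasWeight f S δ w h) (hw : 2 ≤ w) : ‖∑ x, h x‖ ≤ δ ^ (w - 2) * S ^ w := by
  obtain ⟨k, rfl⟩ := Nat.exists_eq_add_of_le hw
  have hS := hf.scale_nonneg
  have hδ := hf.ratio_nonneg
  calc ‖∑ x, h x‖ ≤ ∑ x, ‖h x‖ := _root_.norm_sum_le _ _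
    _ ≤ ∑ x, (δ * S) ^ k * ‖f x‖ ^ 2 := by
        refine Finset.sum_le_sum fun x _ => (hh.norm_le x).trans ?_
        rw [pow_add, mul_comm]
        gcongr
        exact hf.norm_le x
    _ ≤ (δ * S) ^ k * S ^ 2 := by
        rw [← Finset.mul_sum]
        gcongr
        exact hf.sum_sq_le
    _ = δ ^ (2 + k - 2) * S ^ (2 + k) := by
        rw [Nat.add_sub_cancel_left]; ring

lemma HasWeight.norm_sum_le_pow (hf : ScaleControl f S δ) {w : ℕ} {h : β → ℂ}
    (hh : HasWeight f S δ w h) : ‖∑ x, h x‖ ≤ S ^ w := by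
  have hS := hf.scale_nonneg
  have hδ := hf.ratio_nonneg
  rcases eq_or_lt_of_le hh.pos with h1 | h1
  · refine (hh.norm_sum_le h1.symm).trans ?_
    rw [← h1, pow_one]
    exact mul_le_of_le_one_left hS hf.ratio_le_one
  · refine (hh.norm_sum_le_of_two_le hf h1).trans ?_
    exact mul_le_of_le_one_left (by positivity) (pow_le_one₀ hδ hf.ratio_le_one)

/-- Weight 2 is the only one without a gain of δ, which is why only pairings survive in the main
term. -/
lemma HasWeight.norm_sum_le_mul_pow (hf : ScaleControl f S δ) {w : ℕ} {h : β → ℂ}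
    (hh : HasWeight f S δ w h) (hw : w ≠ 2) : ‖∑ x, h x‖ ≤ δ * S ^ w := by
  have hS := hf.scale_nonneg
  have hδ := hf.ratio_nonneg
  rcases eq_or_lt_of_le hh.pos with h1 | h1
  · refine (hh.norm_sum_le h1.symm).trans ?_
    rw [← h1, pow_one]
  · refine (hh.norm_sum_le_of_two_le hf h1).trans ?_
    gcongr
    exact pow_le_of_le_one hδ hf.ratio_le_one (by omega)

variable [DecidableEq ι]

lemma hasWeight_update {I : Finset ι} {n : ι} {w : ι → ℕ} {g : ι → β → ℂ}
    (hg : ∀ i ∈ insert n I, HasWeight f S δ (w i) (g i)) {i : ι} (hi : i ∈ I) :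
    ∀ j ∈ I, HasWeight f S δ (Function.update w i (w i + w n) j)
      (Function.update g i (g i * g n) j) := by
  intro j hj
  rcases eq_or_ne j i with rfl | hji
  · simpa using (hg j (by simp [hi])).mul (hg n (by simp))
  · simpa [hji] using hg j (by simp [hj])

lemma sum_update_weight {I : Finset ι} {n : ι} (hn : n ∉ I) (w : ι → ℕ) {i : ι} (hi : i ∈ I) :
    ∑ j ∈ I, Function.update w i (w i + w n) j = ∑ j ∈ insert n I, w j := by
  rw [Finset.sum_update_of_mem hi, Finset.sum_insert hn, Finset.sdiff_singleton_eq_erase,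
    ← Finset.add_sum_erase I w hi]
  ring

/-- Merging preserves the total weight, and each step of the recursion yields one product and
`I.card` merged terms, whence the factorial. -/
lemma norm_distinctSum_le (hf : ScaleControl f S δ) (I : Finset ι) :
    ∀ (w : ι → ℕ) (g : ι → β → ℂ), (∀ i ∈ I, HasWeight f S δ (w i) (g i)) →
      ‖distinctSum I g‖ ≤ I.card.factorial * S ^ (∑ i ∈ I, w i) := by
  have hS := hf.scale_nonneg
  induction I using Finset.induction_on with
  | empty => intro w g _; simp [distinctSum_empty]
  | insert n I hn ih =>
    intro w g hg
    rw [distinctSum_insert hn, Finset.card_insert_of_notMem hn, Nat.factorial_succ]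
    have hgn := (hg n (by simp)).norm_sum_le_pow hf
    have h1 := ih w g fun i hi => hg i (by simp [hi])
    have h2 : ∀ i ∈ I, ‖distinctSum I (Function.update g i (g i * g n))‖ ≤
        I.card.factorial * S ^ (∑ j ∈ insert n I, w j) := by
      intro i hi
      rw [← sum_update_weight hn w hi]
      exact ih _ _ (hasWeight_update hg hi)
    have h3 := (norm_sum_le _ _).trans (Finset.sum_le_card_nsmul _ _ _ h2)
    refine (norm_sub_le _ _).trans ((add_le_add ((norm_mul_le _ _).trans
      (mul_le_mul hgn h1 (norm_nonneg _) (by positivity))) h3).trans (le_of_eq ?_))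
    rw [Finset.sum_insert hn, nsmul_eq_mul]
    push_cast
    ring

/-- A factor of weight at least 3 stays so under merging. Once it is summed on its own it supplies
the gain δ. -/
lemma norm_distinctSum_le_of_three_le (hf : ScaleControl f S δ) (I : Finset ι) :
    ∀ (w : ι → ℕ) (g : ι → β → ℂ), (∀ i ∈ I, HasWeight f S δ (w i) (g i)) →
      (∃ i ∈ I, 3 ≤ w i) → ‖distinctSum I g‖ ≤ I.card.factorial * (δ * S ^ (∑ i ∈ I, w i)) := by
  have hS := hf.scale_nonneg
  have hδ := hf.ratio_nonneg
  induction I using Finset.induction_on with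
  | empty => rintro w g _ ⟨i, hi, _⟩; simp at hi
  | insert n I hn ih =>
    intro w g hg hw
    rw [distinctSum_insert hn, Finset.card_insert_of_notMem hn, Nat.factorial_succ]
    have hg' : ∀ i ∈ I, HasWeight f S δ (w i) (g i) := fun i hi => hg i (by simp [hi])
    have h1 : ‖(∑ x, g n x) * distinctSum I g‖ ≤
        I.card.factorial * (δ * S ^ (∑ j ∈ insert n I, w j)) := by
      rw [norm_mul, Finset.sum_insert hn]
      by_cases h : 3 ≤ w n
      · refine (mul_le_mul ((hg n (by simp)).norm_sum_le_mul_pow hf (by omega))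
          (norm_distinctSum_le hf I w g hg') (norm_nonneg _) (by positivity)).trans (le_of_eq ?_)
        ring
      · have : ∃ i ∈ I, 3 ≤ w i := by
          obtain ⟨i, hi, h3⟩ := hw
          rcases Finset.mem_insert.1 hi with rfl | hi
          · exact absurd h3 h
          · exact ⟨i, hi, h3⟩
        refine (mul_le_mul ((hg n (by simp)).norm_sum_le_pow hf)
          (ih w g hg' this) (norm_nonneg _) (by positivity)).trans (le_of_eq ?_)
        ring
    have h2 : ∀ i ∈ I, ‖distinctSum I (Function.update g i (g i * g n))‖ ≤
        I.card.factorial * (δ * S ^ (∑ j ∈ insert n I, w j)) := by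
      intro i hi
      rw [← sum_update_weight hn w hi]
      refine ih _ _ (hasWeight_update hg hi) ?_
      obtain ⟨k, hk, h3⟩ := hw
      rcases Finset.mem_insert.1 hk with rfl | hk
      · exact ⟨i, hi, by simp; omega⟩
      · refine ⟨k, hk, ?_⟩
        rcases eq_or_ne k i with rfl | hki
        · simp; omega
        · simpa [hki] using h3
    have h3 := (norm_sum_le _ _).trans (Finset.sum_le_card_nsmul _ _ _ h2)
    refine (norm_sub_le _ _).trans ((add_le_add h1 h3).trans (le_of_eq ?_))
    rw [nsmul_eq_mul]
    push_cast
    ring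

/-- A factor of weight 2 decouples: merging it with any other factor creates weight at least 3,
hence an error O(δ). -/
lemma norm_distinctSum_insert_sub_le (hf : ScaleControl f S δ) {I : Finset ι} {n : ι}
    (hn : n ∉ I) {w : ι → ℕ} {g : ι → β → ℂ}
    (hg : ∀ i ∈ insert n I, HasWeight f S δ (w i) (g i)) (hw : w n = 2) :
    ‖distinctSum (insert n I) g - (∑ x, g n x) * distinctSum I g‖ ≤
      (I.card + 1).factorial * (δ * S ^ (∑ j ∈ insert n I, w j)) := by
  have hS := hf.scale_nonneg
  have hδ := hf.ratio_nonneg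
  have h2 : ∀ i ∈ I, ‖distinctSum I (Function.update g i (g i * g n))‖ ≤
      I.card.factorial * (δ * S ^ (∑ j ∈ insert n I, w j)) := by
    intro i hi
    rw [← sum_update_weight hn w hi]
    refine norm_distinctSum_le_of_three_le hf I _ _ (hasWeight_update hg hi) ⟨i, hi, ?_⟩
    have := (hg i (by simp [hi])).pos
    simp; omega
  have h3 := (norm_sum_le _ _).trans (Finset.sum_le_card_nsmul _ _ _ h2)
  rw [distinctSum_insert hn, sub_sub_cancel_left, norm_neg]
  refine h3.trans ?_
  rw [nsmul_eq_mul, ← mul_assoc]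
  gcongr
  rw [Nat.factorial_succ]
  push_cast
  gcongr
  linarith

/-- One step of the matching expansion: the free sum over the index at `n` is O(δ), so `n` must pair
with some `i`; the pair has weight 2 and decouples. -/
lemma norm_distinctSum_insert_add_le (hf : ScaleControl f S δ) {I : Finset ι} {n : ι}
    (hn : n ∉ I) {g : ι → β → ℂ} (hg : ∀ i ∈ insert n I, HasWeight f S δ 1 (g i)) :
    ‖distinctSum (insert n I) g +
      ∑ i ∈ I, (∑ x, g i x * g n x) * distinctSum (I.erase i) g‖ ≤
      (I.card + 1) * I.card.factorial * (δ * S ^ (I.card + 1)) := by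
  have hS := hf.scale_nonneg
  have hδ := hf.ratio_nonneg
  have h0 : ‖(∑ x, g n x) * distinctSum I g‖ ≤ I.card.factorial * (δ * S ^ (I.card + 1)) := by
    rw [norm_mul]
    refine (mul_le_mul ((hg n (by simp)).norm_sum_le rfl) (norm_distinctSum_le hf I (fun _ => 1) g
      fun i hi => hg i (by simp [hi])) (norm_nonneg _) (by positivity)).trans (le_of_eq ?_)
    simp
    ring
  have h2 : ∀ i ∈ I, ‖(∑ x, g i x * g n x) * distinctSum (I.erase i) g -
      distinctSum I (Function.update g i (g i * g n))‖ ≤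
      I.card.factorial * (δ * S ^ (I.card + 1)) := by
    intro i hi
    have h := norm_distinctSum_insert_sub_le hf (Finset.notMem_erase i I)
      (w := Function.update (fun _ => 1) i (1 + 1)) (g := Function.update g i (g i * g n))
      (by rw [Finset.insert_erase hi]; exact hasWeight_update (w := fun _ => 1) hg hi) (by simp)
    rw [Finset.insert_erase hi, sum_update_weight (w := fun _ => 1) hn hi,
      Finset.card_erase_add_one hi, Function.update_self, norm_sub_rev,
      distinctSum_congr (g := Function.update g i (g i * g n)) (h := g) (I := I.erase i)
        (fun j hj => by rw [Function.update_of_ne (Finset.ne_of_mem_erase hj)])] at h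
    simpa [hn] using h
  have h3 := (norm_sum_le _ _).trans (Finset.sum_le_card_nsmul _ _ _ h2)
  rw [distinctSum_insert hn, sub_add_eq_add_sub, add_sub_assoc,
    ← Finset.sum_sub_distrib]
  refine (norm_add_le _ _).trans ((add_le_add h0 h3).trans (le_of_eq ?_))
  rw [nsmul_eq_mul]
  ring

end Weights

/-! ### The main term as a signed sum over perfect matchings. -/

section Matchings

variable {β : Type*}

/-- `f` or its conjugate. -/
noncomputable def conjIf (f : β → ℂ) (t : Bool) (x : β) : ℂ :=
  if t then f x else conj (f x)

lemma norm_conjIf (f : β → ℂ) (t : Bool) (x : β) : ‖conjIf f t x‖ = ‖f x‖ := by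
  cases t <;> simp [conjIf]

variable [Fintype β] {f : β → ℂ} {S δ : ℝ}

lemma hasWeight_conjIf (hf : ScaleControl f S δ) (t : Bool) :
    HasWeight f S δ 1 (conjIf f t) where
  pos := le_rfl
  norm_le x := by rw [norm_conjIf, pow_one]
  norm_sum_le _ := by
    cases t
    · simpa [conjIf, ← map_sum] using hf.norm_sum_le
    · simpa [conjIf] using hf.norm_sum_le

lemma norm_sum_conjIf_mul_le (hf : ScaleControl f S δ) (t u : Bool) :
    ‖∑ x, conjIf f t x * conjIf f u x‖ ≤ S ^ 2 :=
  ((hasWeight_conjIf hf t).mul (hasWeight_conjIf hf u)).norm_sum_le_pow hf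

lemma sum_conjIf_mul_of_ne (f : β → ℂ) {t u : Bool} (h : t ≠ u) :
    ∑ x, conjIf f t x * conjIf f u x = ((∑ x, ‖f x‖ ^ 2 : ℝ) : ℂ) := by
  push_cast
  refine Finset.sum_congr rfl fun x _ => ?_
  cases t <;> cases u <;> simp_all [conjIf, Complex.mul_conj', Complex.conj_mul']

/-- Up to a relative error `O(δ)`, a distinct sum over copies of `f` and `conj f` is a signed sum
over perfect matchings of the copies. -/
lemma exists_distinctSum_conjIf_approx (n : ℕ) : ∃ C : ℝ, 0 ≤ C ∧
    ∀ {β : Type*} [Fintype β] {f : β → ℂ} {S δ : ℝ}, ScaleControl f S δ →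
    ∀ {ι : Type} [DecidableEq ι] (I : Finset ι) (τ : ι → Bool) (b d : ℕ), I.card = n →
      (I.filter fun i => τ i = true).card = b + 2 * d →
      (I.filter fun i => τ i = false).card = b →
      ∃ q : ℝ, 0 ≤ q ∧ (d = 0 → (∑ x, ‖f x‖ ^ 2) ^ b ≤ q) ∧
        ‖distinctSum I (fun i => conjIf f (τ i)) -
          (-1) ^ (b + d) * (∑ x, f x * f x) ^ d * (q : ℂ)‖ ≤ C * (δ * S ^ n) := by
  -- The excess 2d of unconjugated factors must stay nonnegative when a pair is removed. So an
  -- unconjugated factor is matched if d > 0, and a conjugated one if d = 0; in the latter case a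
  -- pair of two conjugates raises d to 1.
  induction n using Nat.strong_induction_on with
  | _ n ih =>
  rcases Nat.eq_zero_or_pos n with rfl | hn
  · refine ⟨0, le_rfl, fun hf ι _ I τ b d hI ht hb => ⟨1, zero_le_one, ?_, ?_⟩⟩ <;>
    · obtain rfl := Finset.card_eq_zero.1 hI
      simp at ht hb
      obtain rfl := hb.symm
      obtain rfl : d = 0 := by omega
      simp [distinctSum_empty]
  obtain ⟨C, hC, H⟩ := ih (n - 2) (by omega)
  refine ⟨n * (n - 1).factorial + n * C, by positivity, ?_⟩
  intro β _ f S δ hf ι _ I τ b d hI ht hb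
  have hS := hf.scale_nonneg
  have hδ := hf.ratio_nonneg
  have hcard : 2 * b + 2 * d = n := by
    rw [← hI, ← Finset.card_filter_add_card_filter_not (s := I) (fun i => τ i = true)]
    simp only [Bool.not_eq_true]
    omega
  -- the entry to be matched
  obtain ⟨k, hk, hkτ⟩ : ∃ k ∈ I, τ k = decide (d ≠ 0) := by
    rcases eq_or_ne d 0 with rfl | hd
    · obtain ⟨k, hk⟩ := Finset.card_pos.1 (show 0 < (I.filter fun i => τ i = false).card by omega)
      exact ⟨k, by simpa using hk⟩
    · obtain ⟨k, hk⟩ := Finset.card_pos.1 (show 0 < (I.filter fun i => τ i = true).card by omega)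
      exact ⟨k, by simpa [hd] using hk⟩
  set g : ι → β → ℂ := fun i => conjIf f (τ i) with hg
  have key := norm_distinctSum_insert_add_le hf (Finset.notMem_erase k I) (g := g)
    fun i _ => hasWeight_conjIf hf (τ i)
  rw [Finset.insert_erase hk, Finset.card_erase_of_mem hk, hI] at key
  set J := I.erase k with hJ
  set A := ∑ x, f x * f x with hA
  set A₂ := ∑ x, ‖f x‖ ^ 2 with hA₂
  have hA₂0 : 0 ≤ A₂ := by positivity
  have hcount : ∀ i ∈ J, ∀ t : Bool, ((J.erase i).filter fun i => τ i = t).card =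
      (I.filter fun i => τ i = t).card - (if τ k = t then 1 else 0) -
        (if τ i = t then 1 else 0) := by
    intro i hi t
    rw [hJ, Finset.filter_erase, Finset.filter_erase, Finset.card_erase_eq_ite,
      Finset.card_erase_eq_ite]
    have h1 : i ∈ I ∧ i ≠ k := ⟨Finset.mem_of_mem_erase hi, Finset.ne_of_mem_erase hi⟩
    by_cases h2 : τ k = t <;> by_cases h3 : τ i = t <;> simp [h1, h2, h3, hk]
  have hterm : ∀ i ∈ J, ∃ p : ℝ, 0 ≤ p ∧ (d = 0 → τ i = true → A₂ ^ b ≤ p) ∧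
      ‖(∑ x, g i x * g k x) * distinctSum (J.erase i) g +
        (-1) ^ (b + d) * A ^ d * (p : ℂ)‖ ≤ C * (δ * S ^ n) := by
    intro i hi
    have hc1 := hcount i hi true
    have hc2 := hcount i hi false
    have hJi : (J.erase i).card = n - 2 := by
      rw [Finset.card_erase_of_mem hi, hJ, Finset.card_erase_of_mem hk, hI]; omega
    have reduce : ∀ (b' d' : ℕ), ((J.erase i).filter fun i => τ i = true).card = b' + 2 * d' →
        ((J.erase i).filter fun i => τ i = false).card = b' →
        ∃ q : ℝ, 0 ≤ q ∧ (d' = 0 → A₂ ^ b' ≤ q) ∧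
        ‖(∑ x, g i x * g k x) * distinctSum (J.erase i) g -
          (∑ x, g i x * g k x) * ((-1) ^ (b' + d') * A ^ d' * (q : ℂ))‖ ≤ C * (δ * S ^ n) := by
      intro b' d' h1 h2
      obtain ⟨q, hq, hq', hq''⟩ := H hf (J.erase i) τ b' d' hJi h1 h2
      refine ⟨q, hq, hq', ?_⟩
      rw [← mul_sub, norm_mul]
      refine (mul_le_mul (norm_sum_conjIf_mul_le hf (τ i) (τ k)) hq'' (norm_nonneg _)
        (by positivity)).trans (le_of_eq ?_)
      obtain ⟨m, rfl⟩ := Nat.exists_eq_add_of_le (show 2 ≤ n by omega)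
      rw [Nat.add_sub_cancel_left]
      ring
    by_cases hik : τ i = τ k
    · rcases Nat.eq_zero_or_pos d with rfl | hd
      · have hτk : τ k = false := by simpa using hkτ
        have hτi := hik.trans hτk
        rw [hτk, hτi] at hc1 hc2
        have hi2 : 2 ≤ b := by
          rw [← hb, ← Finset.card_pair (Finset.ne_of_mem_erase hi)]
          refine Finset.card_le_card ?_
          intro j hj
          simp only [Finset.mem_insert, Finset.mem_singleton] at hj
          rcases hj with rfl | rfl
          · simp [hτi, Finset.mem_of_mem_erase hi]
          · simp [hτk, hk]
        obtain ⟨m, rfl⟩ := Nat.exists_eq_add_of_le hi2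
        obtain ⟨q, hq, -, hq''⟩ := reduce m 1 (by simp at hc1; omega) (by simp at hc2; omega)
        -- The pair contributes conj A and the remaining factors contribute A, so the product is the
        -- nonnegative number |A|².
        refine ⟨‖A‖ ^ 2 * q, by positivity, fun _ h => by simp [hτi] at h, ?_⟩
        have hsum : ∑ x, g i x * g k x = conj A := by
          simp [hg, conjIf, hτi, hτk, hA]
        rw [hsum] at hq'' ⊢
        convert hq'' using 2
        push_cast
        rw [← Complex.conj_mul' A]
        ring
      · have hτk : τ k = true := by simpa [hd.ne'] using hkτ
        have hτi := hik.trans hτk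
        rw [hτk, hτi] at hc1 hc2
        obtain ⟨e, rfl⟩ := Nat.exists_eq_add_of_le hd
        obtain ⟨q, hq, -, hq''⟩ := reduce b e (by simp at hc1; omega) (by simp at hc2; omega)
        refine ⟨q, hq, fun h => by omega, ?_⟩
        have hsum : ∑ x, g i x * g k x = A := by
          simp [hg, conjIf, hτi, hτk, hA]
        rw [hsum] at hq'' ⊢
        convert hq'' using 2
        ring
    · have hsum := sum_conjIf_mul_of_ne f hik
      have h1 : ∀ t, (if τ k = t then 1 else 0) + (if τ i = t then 1 else 0) = 1 := by
        intro t; revert hik; cases τ k <;> cases τ i <;> cases t <;> simp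
      have hb1 : 1 ≤ b := by
        rw [← hb]
        refine Finset.card_pos.2 ?_
        cases hτ : τ i
        · exact ⟨i, by simp [hτ, Finset.mem_of_mem_erase hi]⟩
        · exact ⟨k, by rw [hτ] at hik; simpa [hk] using Ne.symm hik⟩
      obtain ⟨m, rfl⟩ := Nat.exists_eq_add_of_le hb1
      obtain ⟨q, hq, hq', hq''⟩ := reduce m d (by have := h1 true; omega)
        (by have := h1 false; omega)
      refine ⟨A₂ * q, by positivity, fun h _ => ?_, ?_⟩
      · rw [pow_add, pow_one]
        exact mul_le_mul_of_nonneg_left (hq' h) hA₂0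
      · rw [show ∑ x, g i x * g k x = (A₂ : ℂ) from hsum] at hq'' ⊢
        convert hq'' using 2
        push_cast
        ring
  choose! p hp0 hp1 hp2 using hterm
  refine ⟨∑ i ∈ J, p i, Finset.sum_nonneg hp0, fun hd => ?_, ?_⟩
  · subst hd
    -- One mixed pair already gives the lower bound; all other terms are nonnegative.
    obtain ⟨i, hi⟩ := Finset.card_pos.1 (show 0 < (I.filter fun i => τ i = true).card by omega)
    have hi' : i ∈ I ∧ τ i = true := by simpa using hi
    have hiJ : i ∈ J := Finset.mem_erase.2
      ⟨fun h => by rw [h] at hi'; simp [hkτ] at hi', hi'.1⟩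
    exact (hp1 i hiJ rfl hi'.2).trans (Finset.single_le_sum hp0 hiJ)
  · have h3 := (norm_sum_le _ _).trans (Finset.sum_le_card_nsmul _ _ _ hp2)
    rw [Finset.sum_add_distrib, ← Finset.mul_sum, ← Complex.ofReal_sum] at h3
    have hJn : (J.card : ℝ) ≤ n := by
      rw [hJ, ← hI]; exact_mod_cast Finset.card_le_card (Finset.erase_subset _ _)
    have e1 : ((n - 1 : ℕ) : ℝ) + 1 = n := by exact_mod_cast Nat.sub_add_cancel hn
    rw [e1, Nat.sub_add_cancel hn] at key
    have := norm_sub_le_of_le key h3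
    rw [← sub_sub, add_sub_cancel_right] at this
    refine this.trans ?_
    rw [nsmul_eq_mul, add_mul, mul_assoc (n : ℝ) C]
    gcongr

end Matchings

/-! ### The pointwise inequality. -/

section Pointwise

/-- `‖f‖ ^ 2` as a complex-valued function. -/
noncomputable def normSqFun {β : Type*} (f : β → ℂ) (x : β) : ℂ := (‖f x‖ ^ 2 : ℝ)

lemma hasWeight_normSqFun {β : Type*} [Fintype β] {f : β → ℂ} {S δ : ℝ} :
    HasWeight f S δ 2 (normSqFun f) where
  pos := one_le_two
  norm_le x := by simp [normSqFun]
  norm_sum_le h := by omega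

lemma norm_distinctSum_union_sub_le {ι β : Type*} [Fintype β] [DecidableEq ι] {f : β → ℂ} {S δ : ℝ}
    (hf : ScaleControl f S δ) (I J : Finset ι) {w : ι → ℕ} {g : ι → β → ℂ} (hIJ : Disjoint I J)
    (hI : ∀ i ∈ I, HasWeight f S δ (w i) (g i)) (hw : ∀ i ∈ J, w i = 2)
    (hg : ∀ i ∈ J, g i = normSqFun f) :
    ‖distinctSum (I ∪ J) g - ((∑ x, ‖f x‖ ^ 2 : ℝ) : ℂ) ^ J.card * distinctSum I g‖ ≤
      J.card * (I.card + J.card).factorial * (δ * S ^ (∑ i ∈ I ∪ J, w i)) := by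
  have hS := hf.scale_nonneg
  have hδ := hf.ratio_nonneg
  induction J using Finset.induction_on with
  | empty => simp
  | insert n J hn ih =>
    have hnI : n ∉ I := fun h => Finset.disjoint_left.1 hIJ h (by simp)
    have hn' : n ∉ I ∪ J := by simp [hn, hnI]
    have h1 := ih (hIJ.mono_right (Finset.subset_insert _ _)) (fun i hi => hw i (by simp [hi]))
      (fun i hi => hg i (by simp [hi]))
    have hsum : ∑ x, g n x = ((∑ x, ‖f x‖ ^ 2 : ℝ) : ℂ) := by
      rw [hg n (by simp)]; simp [normSqFun]
    have hwn : w n = 2 := hw n (by simp)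
    have h2 := norm_distinctSum_insert_sub_le hf hn' (w := w) (g := g) (by
      intro i hi
      by_cases hiI : i ∈ I
      · exact hI i hiI
      · have : i ∈ insert n J := by
          simp only [Finset.mem_insert, Finset.mem_union] at hi ⊢; tauto
        rw [hg i this, hw i this]
        exact hasWeight_normSqFun) hwn
    rw [hsum, Finset.card_union_of_disjoint (hIJ.mono_right (Finset.subset_insert _ _))] at h2
    rw [Finset.union_insert, Finset.card_insert_of_notMem hn]
    set A := ∑ x, ‖f x‖ ^ 2 with hA
    have hA0 : 0 ≤ A := by positivity
    have h3 : ‖(A : ℂ) * distinctSum (I ∪ J) g - (A : ℂ) ^ (J.card + 1) * distinctSum I g‖ ≤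
        J.card * (I.card + J.card).factorial * (δ * S ^ (∑ i ∈ insert n (I ∪ J), w i)) := by
      rw [pow_succ', mul_assoc, ← mul_sub, norm_mul, Complex.norm_of_nonneg hA0,
        Finset.sum_insert hn', hwn]
      refine (mul_le_mul hf.sum_sq_le h1 (norm_nonneg _) (by positivity)).trans (le_of_eq ?_)
      ring
    refine (norm_sub_le_norm_sub_add_norm_sub _ _ _).trans ((add_le_add h2 h3).trans ?_)
    have h4 : ((I.card + J.card).factorial : ℝ) ≤ (I.card + J.card + 1).factorial := by
      exact_mod_cast Nat.factorial_le (Nat.le_succ _)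
    rw [← add_mul, ← add_assoc]
    push_cast
    gcongr
    linarith [mul_le_mul_of_nonneg_left h4 (Nat.cast_nonneg (α := ℝ) J.card)]

lemma card_filter_even_range (m : ℕ) (t : Bool) :
    ((Finset.range (2 * m)).filter fun i => decide (Even i) = t).card = m := by
  induction m with
  | zero => simp
  | succ m ih =>
    rw [show 2 * (m + 1) = 2 * m + 1 + 1 by ring, Finset.range_add_one, Finset.range_add_one,
      Finset.filter_insert, Finset.filter_insert]
    cases t <;> simp_all

/-- The positions of the independent indices in a tuple of Type IV. -/
def typeIVPositions (m s : ℕ) : Finset ℕ :=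
  Finset.range (2 * m) ∪ (Finset.Ico m (m + s)).image (2 * ·)

/-- The factors attached to the positions of `typeIVPositions`. -/
noncomputable def typeIVFactor {β : Type*} (m : ℕ) (f : β → ℂ) (i : ℕ) : β → ℂ :=
  if i < 2 * m then conjIf f (decide (Even i)) else normSqFun f

lemma disjoint_typeIVPositions (m s : ℕ) :
    Disjoint (Finset.range (2 * m)) ((Finset.Ico m (m + s)).image (2 * ·)) := by
  rw [Finset.disjoint_left]
  intro i hi hi'
  simp only [Finset.mem_range, Finset.mem_image, Finset.mem_Ico] at hi hi'
  omega

lemma card_image_double (m s : ℕ) : ((Finset.Ico m (m + s)).image (2 * ·)).card = s := by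
  rw [Finset.card_image_of_injective _ (fun a b h => by simpa using h)]
  simp

lemma sum_typeIV_weight (m s : ℕ) :
    ∑ i ∈ typeIVPositions m s, (if i < 2 * m then 1 else 2) = 2 * (m + s) := by
  rw [typeIVPositions, Finset.sum_union (disjoint_typeIVPositions m s),
    Finset.sum_congr rfl (g := fun _ => 1),
    Finset.sum_congr (s₂ := (Finset.Ico m (m + s)).image (2 * ·)) rfl (g := fun _ => 2)]
  · simp only [Finset.sum_const, card_image_double, Finset.card_range, smul_eq_mul]
    ring
  · intro i hi
    simp only [Finset.mem_image, Finset.mem_Ico] at hi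
    rw [if_neg (by omega)]
  · intro i hi
    rw [if_pos (Finset.mem_range.1 hi)]

lemma hasWeight_typeIVFactor {β : Type*} [Fintype β] {f : β → ℂ} {S δ : ℝ}
    (hf : ScaleControl f S δ) (m i : ℕ) :
    HasWeight f S δ (if i < 2 * m then 1 else 2) (typeIVFactor m f i) := by
  unfold typeIVFactor
  split_ifs
  · exact hasWeight_conjIf hf _
  · exact hasWeight_normSqFun

lemma exists_typeIV_re_ge (m s : ℕ) : ∃ C : ℝ, 0 ≤ C ∧
    ∀ {β : Type*} [Fintype β] {f : β → ℂ} {S δ : ℝ}, ScaleControl f S δ →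
      S ^ 2 = ∑ x, ‖f x‖ ^ 2 →
      (1 - C * δ) * S ^ (2 * (m + s)) ≤
        (-1) ^ m * (distinctSum (typeIVPositions m s) (typeIVFactor m f)).re := by
  obtain ⟨C, hC, H⟩ := exists_distinctSum_conjIf_approx (2 * m)
  refine ⟨s * (2 * m + s).factorial + C, by positivity, ?_⟩
  intro β _ f S δ hf hS2
  have hS := hf.scale_nonneg
  have hδ := hf.ratio_nonneg
  obtain ⟨q, hq0, hq, hD⟩ := H hf (Finset.range (2 * m)) (fun i => decide (Even i)) m 0
    (by simp) (by rw [card_filter_even_range]; rfl) (by rw [card_filter_even_range])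
  rw [← distinctSum_congr (I := Finset.range (2 * m)) (g := typeIVFactor m f) (fun i hi => by
    simp [typeIVFactor, Finset.mem_range.1 hi])] at hD
  rw [← hS2] at hq
  have h1 := norm_distinctSum_union_sub_le hf (Finset.range (2 * m)) _ (g := typeIVFactor m f)
    (disjoint_typeIVPositions m s) (fun i _ => hasWeight_typeIVFactor hf m i)
    (fun i hi => by
      simp only [Finset.mem_image, Finset.mem_Ico] at hi
      rw [if_neg (by omega)])
    (fun i hi => by
      simp only [Finset.mem_image, Finset.mem_Ico] at hi
      rw [typeIVFactor, if_neg (by omega)])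
  rw [← typeIVPositions, sum_typeIV_weight, card_image_double, Finset.card_range, ← hS2] at h1
  have h2 : ‖((S ^ 2 : ℝ) : ℂ) ^ s * distinctSum (Finset.range (2 * m)) (typeIVFactor m f) -
      ((S ^ 2 : ℝ) : ℂ) ^ s * ((-1) ^ m * (q : ℂ))‖ ≤ C * (δ * S ^ (2 * (m + s))) := by
    rw [← mul_sub, norm_mul, norm_pow, Complex.norm_of_nonneg (by positivity)]
    simp only [add_zero, pow_zero, mul_one] at hD
    refine (mul_le_mul_of_nonneg_left hD (by positivity)).trans (le_of_eq ?_)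
    ring
  have h3 := (norm_sub_le_norm_sub_add_norm_sub _ _ _).trans (add_le_add h1 h2)
  have h4 : ‖(-1) ^ m * distinctSum (typeIVPositions m s) (typeIVFactor m f) -
      ((S ^ 2) ^ s * q : ℝ)‖ ≤ (s * (2 * m + s).factorial + C) * δ * S ^ (2 * (m + s)) := by
    have e : (-1 : ℂ) ^ m * (-1) ^ m = 1 := by rw [← mul_pow]; simp
    have : (-1) ^ m * distinctSum (typeIVPositions m s) (typeIVFactor m f) -
      ((S ^ 2) ^ s * q : ℝ) = (-1) ^ m * (distinctSum (typeIVPositions m s) (typeIVFactor m f) -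
        ((S ^ 2 : ℝ) : ℂ) ^ s * ((-1) ^ m * (q : ℂ))) := by
      push_cast
      linear_combination (((S : ℂ) ^ 2) ^ s * q) * e
    rw [this, norm_mul, norm_pow, norm_neg, norm_one, one_pow, one_mul]
    refine h3.trans (le_of_eq ?_)
    ring
  have h5 := (abs_le.1 ((Complex.abs_re_le_norm _).trans h4)).1
  have e : ((-1 : ℂ) ^ m) = ((-1 : ℝ) ^ m : ℝ) := by push_cast; rfl
  rw [Complex.sub_re, e, Complex.re_ofReal_mul, Complex.ofReal_re] at h5
  have h6 : S ^ (2 * (m + s)) ≤ (S ^ 2) ^ s * q := by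
    calc S ^ (2 * (m + s)) = (S ^ 2) ^ s * (S ^ 2) ^ m := by ring
      _ ≤ _ := by gcongr; exact hq rfl
  linarith

lemma exists_sum_sq_pow_le (m s : ℕ) : ∃ K : ℝ, 0 ≤ K ∧
    ∀ {β : Type*} [Fintype β] (f : β → ℂ),
      (∑ x, ‖f x‖ ^ 2) ^ (m + s) ≤
        2 * ((-1) ^ m * (distinctSum (typeIVPositions m s) (typeIVFactor m f)).re) +
          K * (‖∑ x, f x‖ ^ (2 * (m + s)) + ∑ x, ‖f x‖ ^ (2 * (m + s))) := by
  obtain ⟨C, hC, H⟩ := exists_typeIV_re_ge m s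
  set N : ℝ := (((typeIVPositions m s).card.factorial : ℕ) : ℝ)
  -- Chosen so that 1 - Cδ ≥ 1/2; this is the source of the factor 2 in front of the distinct sum.
  set δ : ℝ := 1 / (2 * C + 1) with hδ
  have hδ0 : 0 < δ := by positivity
  have hδ1 : δ ≤ 1 := by rw [hδ, div_le_one (by positivity)]; linarith
  have hCδ : C * δ ≤ 1 / 2 := by
    rw [hδ, mul_one_div, div_le_div_iff₀ (by positivity) (by positivity)]; linarith
  set R : ℝ := 1 / δ ^ (2 * (m + s))
  refine ⟨R + 2 * (N * (R + 1)), by positivity, ?_⟩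
  intro β _ f
  set S : ℝ := √(∑ x, ‖f x‖ ^ 2) with hS
  have hS0 : 0 ≤ S := Real.sqrt_nonneg _
  have hS2 : S ^ 2 = ∑ x, ‖f x‖ ^ 2 := Real.sq_sqrt (by positivity)
  have hfS : ∀ x, ‖f x‖ ≤ S := fun x => by
    refine Real.le_sqrt_of_sq_le ?_
    exact Finset.single_le_sum (f := fun x => ‖f x‖ ^ 2) (fun _ _ => by positivity)
      (Finset.mem_univ x)
  set G := ‖∑ x, f x‖ ^ (2 * (m + s)) + ∑ x, ‖f x‖ ^ (2 * (m + s)) with hG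
  have hG0 : 0 ≤ G := by positivity
  have hFG : ‖∑ x, f x‖ ^ (2 * (m + s)) ≤ G := le_add_of_nonneg_right (by positivity)
  have hfG : ∀ x, ‖f x‖ ^ (2 * (m + s)) ≤ G := fun x =>
    (Finset.single_le_sum (f := fun x => ‖f x‖ ^ (2 * (m + s))) (fun _ _ => by positivity)
      (Finset.mem_univ x)).trans (le_add_of_nonneg_left (by positivity))
  rw [← hS2, ← pow_mul]
  by_cases hc : (∀ x, ‖f x‖ ≤ δ * S) ∧ ‖∑ x, f x‖ ≤ δ * S
  · have h1 := H ⟨hS0, hδ0.le, hδ1, hS2.ge, hc.1, hc.2⟩ hS2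
    have h2 : (1 / 2) * S ^ (2 * (m + s)) ≤ (1 - C * δ) * S ^ (2 * (m + s)) := by
      gcongr; linarith
    have h3 : 0 ≤ (R + 2 * (N * (R + 1))) * G := by positivity
    linarith
  · have h1 : (δ * S) ^ (2 * (m + s)) ≤ G := by
      rw [not_and_or, not_forall] at hc
      rcases hc with ⟨x, hx⟩ | hx
      · exact (pow_le_pow_left₀ (by positivity) (not_le.1 hx).le _).trans (hfG x)
      · exact (pow_le_pow_left₀ (by positivity) (not_le.1 hx).le _).trans hFG
    have h2 : S ^ (2 * (m + s)) ≤ R * G := by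
      rw [mul_pow] at h1
      rw [one_div_mul_eq_div, le_div_iff₀ (by positivity)]
      linarith
    -- Here |F| may exceed S, so the crude bound is applied at the larger scale T with δ = 1.
    set T := max S ‖∑ x, f x‖
    have hT : ScaleControl f T 1 :=
      ⟨hS0.trans (le_max_left _ _), zero_le_one, le_rfl,
        hS2 ▸ pow_le_pow_left₀ hS0 (le_max_left _ _) 2,
        fun x => by rw [one_mul]; exact (hfS x).trans (le_max_left _ _),
        by rw [one_mul]; exact le_max_right _ _⟩
    have h3 := norm_distinctSum_le hT (typeIVPositions m s) _ _
      fun i _ => hasWeight_typeIVFactor hT m i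
    rw [sum_typeIV_weight] at h3
    have h4 : T ^ (2 * (m + s)) ≤ (R + 1) * G := by
      rcases max_choice S ‖∑ x, f x‖ with h | h <;> simp only [T, h] <;>
        nlinarith [show 0 ≤ R * G by positivity]
    have h5 : |(-1) ^ m * (distinctSum (typeIVPositions m s) (typeIVFactor m f)).re| ≤
        N * ((R + 1) * G) := by
      rw [abs_mul, abs_pow, abs_neg, abs_one, one_pow, one_mul]
      exact (Complex.abs_re_le_norm _).trans (h3.trans (by gcongr))
    have h6 := (abs_le.1 h5).1
    linarith

end Pointwise

/-! ### Type IV tuples as families of distinct indices. -/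

section Tuples

/-- The independent position which determines the index at position `i`. -/
def rootPosition (m i : ℕ) : ℕ := if i < 2 * m then i else 2 * (i / 2)

lemma rootPosition_mem {m s i : ℕ} (hi : i < 2 * (m + s)) :
    rootPosition m i ∈ typeIVPositions m s := by
  unfold rootPosition typeIVPositions
  split_ifs with h
  · simp [h]
  · refine Finset.mem_union_right _ (Finset.mem_image.2 ⟨i / 2, ?_, rfl⟩)
    rw [Finset.mem_Ico]
    omega

/-- The tuple of Type IV with prescribed independent indices. -/
def typeIVTuple {m s L : ℕ} (e : typeIVPositions m s ↪ Fin L) (i : Fin (2 * (m + s))) : Fin L :=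
  e ⟨rootPosition m i, rootPosition_mem i.2⟩

lemma isTypeIVTuple_typeIVTuple {m s L : ℕ} (e : typeIVPositions m s ↪ Fin L) :
    IsTypeIVTuple (m + s) s (typeIVTuple e) where
  distinct i hi k hk h := by
    have h1 := Subtype.ext_iff.1 (e.injective h)
    simp only [rootPosition, Set.mem_ofPred_eq, Nat.even_iff] at h1 hi hk
    ext
    split_ifs at h1 <;> omega
  paired i k hi hi' hk := by
    unfold typeIVTuple
    congr 2
    simp only [rootPosition, Nat.even_iff] at *
    split_ifs <;> omega

/-- From position 2m on, positions 2j and 2j + 1 share a root, so each such pair collapses to z ·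
conj z = |z|². -/
lemma prod_range_rootPosition (m s : ℕ) (z : ℕ → ℂ) :
    ∏ i ∈ Finset.range (2 * (m + s)),
        (if Even i then z (rootPosition m i) else conj (z (rootPosition m i))) =
      ∏ i ∈ typeIVPositions m s,
        if i < 2 * m then (if Even i then z i else conj (z i)) else ((‖z i‖ ^ 2 : ℝ) : ℂ) := by
  induction s with
  | zero =>
    simp only [typeIVPositions, add_zero, Finset.Ico_self, Finset.image_empty, Finset.union_empty]
    refine Finset.prod_congr rfl fun i hi => ?_
    rw [Finset.mem_range] at hi
    simp only [rootPosition, hi, if_true]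
  | succ s ih =>
    have h1 : typeIVPositions m (s + 1) = insert (2 * (m + s)) (typeIVPositions m s) := by
      ext i
      simp only [typeIVPositions, Finset.mem_union, Finset.mem_image, Finset.mem_Ico,
        Finset.mem_insert, Finset.mem_range]
      constructor
      · rintro (h | ⟨a, ha, rfl⟩)
        · tauto
        · rcases eq_or_ne a (m + s) with rfl | h
          · exact Or.inl rfl
          · exact Or.inr (Or.inr ⟨a, by omega, rfl⟩)
      · rintro (rfl | h | ⟨a, ha, rfl⟩)
        · exact Or.inr ⟨m + s, by omega, rfl⟩
        · exact Or.inl h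
        · exact Or.inr ⟨a, by omega, rfl⟩
    have h2 : 2 * (m + s) ∉ typeIVPositions m s := by
      simp only [typeIVPositions, Finset.mem_union, Finset.mem_image, Finset.mem_Ico,
        Finset.mem_range]
      omega
    have h3 : rootPosition m (2 * (m + s)) = 2 * (m + s) := by
      unfold rootPosition; split_ifs <;> omega
    have h4 : rootPosition m (2 * (m + s) + 1) = 2 * (m + s) := by
      unfold rootPosition; split_ifs <;> omega
    rw [h1, Finset.prod_insert h2, ← ih, show 2 * (m + (s + 1)) = 2 * (m + s) + 1 + 1 by ring,
      Finset.prod_range_succ, Finset.prod_range_succ, h3, h4, if_pos (even_two_mul _),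
      if_neg (by simp), if_neg (by omega), mul_assoc, Complex.mul_conj', mul_comm]
    push_cast
    rfl

lemma distinctSum_eq_sum_alternatingProduct {X : Type*} {L : ℕ} (m s : ℕ) (f : Fin L → X → ℂ)
    (x : X) :
    distinctSum (typeIVPositions m s) (typeIVFactor m fun l => f l x) =
      ∑ e : typeIVPositions m s ↪ Fin L, alternatingProduct (m + s) f (typeIVTuple e) x := by
  refine Finset.sum_congr rfl fun e _ => ?_
  let z : ℕ → ℂ := fun i => if h : i ∈ typeIVPositions m s then f (e ⟨i, h⟩) x else 0
  have h1 : alternatingProduct (m + s) f (typeIVTuple e) x = ∏ i ∈ Finset.range (2 * (m + s)),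
      (if Even i then z (rootPosition m i) else conj (z (rootPosition m i))) := by
    rw [alternatingProduct, Finset.prod_range]
    refine Finset.prod_congr rfl fun i _ => ?_
    simp only [z, dif_pos (rootPosition_mem i.2), typeIVTuple]
  rw [h1, prod_range_rootPosition, ← Finset.prod_coe_sort (typeIVPositions m s)]
  refine Finset.prod_congr rfl fun i _ => ?_
  simp only [z, dif_pos i.2, typeIVFactor]
  split_ifs <;> simp_all [conjIf, normSqFun]

end Tuples

/-! ### Integration of the pointwise inequality. -/

section Integration

variable {X : Type*}

/-- Every factor is at most the largest one. This makes the product integrable without Hölder's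
inequality. -/
lemma norm_alternatingProduct_le {L r : ℕ} (hr : 1 ≤ r) (f : Fin L → X → ℂ)
    (l : Fin (2 * r) → Fin L) (x : X) :
    ‖alternatingProduct r f l x‖ ≤ ∑ k, ‖f k x‖ ^ (2 * r) := by
  have : Nonempty (Fin (2 * r)) := ⟨⟨0, by omega⟩⟩
  obtain ⟨j, -, hj⟩ := Finset.exists_max_image Finset.univ (fun i => ‖f (l i) x‖)
    Finset.univ_nonempty
  calc ‖alternatingProduct r f l x‖ = ∏ i, ‖f (l i) x‖ := by
        rw [alternatingProduct, norm_prod]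
        refine Finset.prod_congr rfl fun i _ => ?_
        split_ifs <;> simp
    _ ≤ ∏ _i : Fin (2 * r), ‖f (l j) x‖ :=
        Finset.prod_le_prod (fun _ _ => norm_nonneg _) fun i hi => hj i hi
    _ = ‖f (l j) x‖ ^ (2 * r) := by simp
    _ ≤ _ := Finset.single_le_sum (f := fun k => ‖f k x‖ ^ (2 * r))
        (fun _ _ => by positivity) (Finset.mem_univ _)

variable [MeasurableSpace X] {μ : Measure X}

lemma integrable_sum_norm_pow {L r : ℕ} (hr : 1 ≤ r) {f : Fin L → X → ℂ}
    (hf : ∀ l, MemLp (f l) ((2 * r : ℕ) : ℝ≥0∞) μ) :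
    Integrable (fun x => ∑ k, ‖f k x‖ ^ (2 * r)) μ :=
  integrable_finsetSum _ fun k _ => (hf k).integrable_norm_pow (by omega)

lemma integrable_alternatingProduct {L r : ℕ} (hr : 1 ≤ r) {f : Fin L → X → ℂ}
    (hf : ∀ l, MemLp (f l) ((2 * r : ℕ) : ℝ≥0∞) μ) (l : Fin (2 * r) → Fin L) :
    Integrable (alternatingProduct r f l) μ := by
  refine (integrable_sum_norm_pow hr hf).mono' ?_
    (Filter.Eventually.of_forall (norm_alternatingProduct_le hr f l))
  refine Finset.aestronglyMeasurable_fun_prod _ fun i _ => ?_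
  split_ifs
  · exact (hf _).1
  · exact Complex.continuous_conj.comp_aestronglyMeasurable (hf _).1

lemma eLpNorm_natCast_pow {E : Type*} [NormedAddCommGroup E] {n : ℕ} (hn : n ≠ 0) (g : X → E) :
    eLpNorm g (n : ℝ≥0∞) μ ^ n = ∫⁻ x, ‖g x‖ₑ ^ n ∂μ := by
  have := eLpNorm_nnreal_pow_eq_lintegral (f := g) (μ := μ) (p := (n : ℝ≥0)) (by simpa using hn)
  simpa using this

lemma lintegral_sum_sq_pow_le {m s L : ℕ} (hr : 1 ≤ m + s) {K : ℝ} (hK : 0 ≤ K)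
    (H : ∀ f : Fin L → ℂ, (∑ x, ‖f x‖ ^ 2) ^ (m + s) ≤
        2 * ((-1) ^ m * (distinctSum (typeIVPositions m s) (typeIVFactor m f)).re) +
          K * (‖∑ x, f x‖ ^ (2 * (m + s)) + ∑ x, ‖f x‖ ^ (2 * (m + s))))
    {f : Fin L → X → ℂ} (hf : ∀ l, MemLp (f l) ((2 * (m + s) : ℕ) : ℝ≥0∞) μ)
    (hIV : TypeIVSuperorthogonal μ (m + s) s f) :
    ∫⁻ x, ENNReal.ofReal ((∑ l, ‖f l x‖ ^ 2) ^ (m + s)) ∂μ ≤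
      ENNReal.ofReal K * (∫⁻ x, ENNReal.ofReal (‖∑ l, f l x‖ ^ (2 * (m + s))) ∂μ +
        ∫⁻ x, ENNReal.ofReal (∑ l, ‖f l x‖ ^ (2 * (m + s))) ∂μ) := by
  have hT : ∀ e : typeIVPositions m s ↪ Fin L, Integrable
      (fun x => alternatingProduct (m + s) f (typeIVTuple e) x) μ :=
    fun e => integrable_alternatingProduct hr hf _
  have hD : Integrable (fun x => distinctSum (typeIVPositions m s)
      (typeIVFactor m fun l => f l x)) μ := by
    simp only [distinctSum_eq_sum_alternatingProduct]
    exact integrable_finsetSum _ fun e _ => hT e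
  have hD0 : ∫ x, distinctSum (typeIVPositions m s) (typeIVFactor m fun l => f l x) ∂μ = 0 := by
    simp only [distinctSum_eq_sum_alternatingProduct]
    rw [integral_finsetSum _ fun e _ => hT e]
    exact Finset.sum_eq_zero fun e _ => hIV _ (isTypeIVTuple_typeIVTuple e)
  have hRe : ∫ x, (distinctSum (typeIVPositions m s) (typeIVFactor m fun l => f l x)).re ∂μ =
      0 := by
    have := integral_re hD
    simpa [hD0] using this
  have hF : Integrable (fun x => ‖∑ l, f l x‖ ^ (2 * (m + s))) μ :=
    (memLp_finsetSum Finset.univ fun l _ => hf l).integrable_norm_pow (by omega)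
  have hM := integrable_sum_norm_pow hr hf
  have hD1 := (hD.re.const_mul ((-1) ^ m)).const_mul 2
  have hG := (hF.add hM).const_mul K
  have hsum := hD1.add hG
  have hle : ∀ x, (∑ l, ‖f l x‖ ^ 2) ^ (m + s) ≤
      2 * ((-1) ^ m * (distinctSum (typeIVPositions m s) (typeIVFactor m fun l => f l x)).re) +
        K * (‖∑ l, f l x‖ ^ (2 * (m + s)) + ∑ l, ‖f l x‖ ^ (2 * (m + s))) :=
    fun x => H fun l => f l x
  calc ∫⁻ x, ENNReal.ofReal ((∑ l, ‖f l x‖ ^ 2) ^ (m + s)) ∂μ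
      ≤ ∫⁻ x, ENNReal.ofReal (2 * ((-1) ^ m * (distinctSum (typeIVPositions m s)
          (typeIVFactor m fun l => f l x)).re) +
          K * (‖∑ l, f l x‖ ^ (2 * (m + s)) + ∑ l, ‖f l x‖ ^ (2 * (m + s)))) ∂μ :=
        lintegral_mono fun x => ENNReal.ofReal_le_ofReal (hle x)
    _ = ENNReal.ofReal (∫ x, (2 * ((-1) ^ m * (distinctSum (typeIVPositions m s)
          (typeIVFactor m fun l => f l x)).re) +
          K * (‖∑ l, f l x‖ ^ (2 * (m + s)) + ∑ l, ‖f l x‖ ^ (2 * (m + s)))) ∂μ) :=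
        (ofReal_integral_eq_lintegral_ofReal hsum (Filter.Eventually.of_forall fun x =>
          le_trans (by positivity) (hle x))).symm
    _ = ENNReal.ofReal (K * (∫ x, ‖∑ l, f l x‖ ^ (2 * (m + s)) ∂μ +
          ∫ x, ∑ l, ‖f l x‖ ^ (2 * (m + s)) ∂μ)) := by
        congr 1
        refine (integral_add hD1 hG).trans ?_
        rw [integral_const_mul, integral_const_mul, integral_const_mul]
        refine (congrArg₂ (· + ·) (congrArg (2 * ((-1) ^ m * ·)) hRe) (congrArg (K * ·)
          (integral_add hF hM))).trans ?_
        simp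
    _ = _ := by
        rw [ENNReal.ofReal_mul hK, ENNReal.ofReal_add (integral_nonneg fun x => by positivity)
          (integral_nonneg fun x => by positivity),
          ofReal_integral_eq_lintegral_ofReal hF (Filter.Eventually.of_forall fun x => by positivity),
          ofReal_integral_eq_lintegral_ofReal hM (Filter.Eventually.of_forall fun x => by positivity)]

lemma enorm_rpow_pow_eq {y p : ℝ} {n k : ℕ} (hy : 0 ≤ y) (h : p * n = k) :
    ‖y ^ p‖ₑ ^ n = ENNReal.ofReal (y ^ k) := by
  rw [Real.enorm_of_nonneg (by positivity), ← ENNReal.ofReal_pow (by positivity),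
    ← Real.rpow_natCast (y ^ p), ← Real.rpow_mul hy, h, Real.rpow_natCast]

end Integration

theorem mainTheorem7 (r : ℕ) (hr : 1 ≤ r) (C₀ : ℝ≥0) :
    ∃ C : ℝ≥0, ∀ (X : Type*) [MeasurableSpace X] (μ : Measure X) [SigmaFinite μ]
      (s : ℕ) (_ : s ≤ r) (L : ℕ) (f : Fin L → X → ℂ)
      (_ : ∀ l, MemLp (f l) ((2 * r : ℕ) : ℝ≥0∞) μ)
      (_ : TypeIVSuperorthogonal μ r s f)
      (_ : eLpNorm (fun x => (∑ l, ‖f l x‖ ^ (2 * r)) ^ (1 / (2 * (r : ℝ)))) ((2 * r : ℕ) : ℝ≥0∞) μ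
        ≤ (C₀ : ℝ≥0∞) * eLpNorm (fun x => ∑ l, f l x) ((2 * r : ℕ) : ℝ≥0∞) μ),
      eLpNorm (fun x => (∑ l, ‖f l x‖ ^ 2) ^ ((1 : ℝ) / 2)) ((2 * r : ℕ) : ℝ≥0∞) μ
        ≤ (C : ℝ≥0∞) * eLpNorm (fun x => ∑ l, f l x) ((2 * r : ℕ) : ℝ≥0∞) μ := by
  choose K hK H using exists_sum_sq_pow_le
  -- Summing over all s ≤ r makes the constant independent of s.
  set K₁ : ℝ≥0 := ∑ s ∈ Finset.range (r + 1), (K (r - s) s).toNNReal with hK₁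
  -- The added 1 gives C ≤ C^(2r), which avoids extracting a 2r-th root.
  refine ⟨1 + K₁ * (1 + C₀ ^ (2 * r)), ?_⟩
  intro X _ μ _ s hs L f hf hIV hM
  have hr0 : (r : ℝ) ≠ 0 := by positivity
  have hn : 2 * r ≠ 0 := by omega
  have hKs : ENNReal.ofReal (K (r - s) s) ≤ K₁ := by
    refine ENNReal.coe_le_coe.2 ?_
    exact Finset.single_le_sum (f := fun s => (K (r - s) s).toNNReal) (fun _ _ => zero_le)
      (Finset.mem_range.2 (by omega))
  have key : ∫⁻ x, ENNReal.ofReal ((∑ l, ‖f l x‖ ^ 2) ^ r) ∂μ ≤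
      ENNReal.ofReal (K (r - s) s) * (∫⁻ x, ENNReal.ofReal (‖∑ l, f l x‖ ^ (2 * r)) ∂μ +
        ∫⁻ x, ENNReal.ofReal (∑ l, ‖f l x‖ ^ (2 * r)) ∂μ) := by
    obtain ⟨m, rfl⟩ := Nat.exists_eq_add_of_le' hs
    rw [Nat.add_sub_cancel]
    exact lintegral_sum_sq_pow_le hr (hK m s) (fun g => H m s g) hf hIV
  have hM' := pow_le_pow_left₀ (zero_le) hM (2 * r)
  rw [mul_pow, eLpNorm_natCast_pow hn] at hM'
  have hMx : ∀ x, ‖(∑ l, ‖f l x‖ ^ (2 * r)) ^ (1 / (2 * (r : ℝ)))‖ₑ ^ (2 * r) =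
      ENNReal.ofReal (∑ l, ‖f l x‖ ^ (2 * r)) := fun x => by
    rw [enorm_rpow_pow_eq (k := 1) (by positivity) (by push_cast; field_simp), pow_one]
  have hSx : ∀ x, ‖(∑ l, ‖f l x‖ ^ 2) ^ ((1 : ℝ) / 2)‖ₑ ^ (2 * r) =
      ENNReal.ofReal ((∑ l, ‖f l x‖ ^ 2) ^ r) := fun x =>
    enorm_rpow_pow_eq (by positivity) (by push_cast; field_simp)
  simp only [hMx] at hM'
  have hF : eLpNorm (fun x => ∑ l, f l x) ((2 * r : ℕ) : ℝ≥0∞) μ ^ (2 * r) =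
      ∫⁻ x, ENNReal.ofReal (‖∑ l, f l x‖ ^ (2 * r)) ∂μ := by
    rw [eLpNorm_natCast_pow hn]
    simp [ENNReal.ofReal_pow]
  rw [← ENNReal.pow_le_pow_left_iff hn, mul_pow, eLpNorm_natCast_pow hn]
  simp only [hSx]
  refine key.trans ((mul_le_mul' hKs (add_le_add hF.ge hM')).trans ?_)
  rw [← one_add_mul, ← mul_assoc]
  gcongr
  have : K₁ * (1 + C₀ ^ (2 * r)) ≤ (1 + K₁ * (1 + C₀ ^ (2 * r))) ^ (2 * r) :=
    le_add_self.trans (le_self_pow₀ le_self_add hn)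
  exact_mod_cast this
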